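/- Let $V_0$ be the access structure on the set of parties $\{1,\dots,7\}$ (a port of the Vámos matroid) whose minimal qualified sets are $\{1,2,3\}$, $\{1,4,5\}$ and all $4$-element subsets of $\{1,\dots,7\}$ that contain neither of these two sets and are different from $\{2,3,4,5\}$, $\{2,3,6,7\}$ and $\{4,5,6,7\}$. Let $S_0,S_1,\dots,S_7$ be jointly distributed finite-valued random variables ($S_0$ is the secret, $S_1,\dots,S_7$ are the shares), let $H$ denote Shannon entropy, $S_V=(S_i)_{i\in V}$ and $H(S_0\mid S_V)=H(S_0,S_V)-H(S_V)$. Suppose that $H(S_0)>0$ and that $(S_0,\dots,S_7)$ is a perfect secret sharing scheme for $V_0$, that is, (i) $H(S_0\mid S_V)=0$ for every minimal qualified set $V$; (ii) $H(S_0\mid S_V)=H(S_0)$ for every $V\subseteq\{1,\dots,7\}$ that includes no minimal qualified set. Then the information ratio of the scheme satisfies $$\frac{\max\{H(S_1),\dots,H(S_7)\}}{H(S_0)}\ \ge\ \frac{561}{491}=1.142566\ldots$$ Equivalently, the optimal information ratio (the infimum of this ratio over all such schemes) is at least $561/491$. -/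

import Mathlib

open MeasureTheory

noncomputable section

namespace SecretSharing

/-- Shannon entropy of a finite-valued random variable `X` on the probability space `(Ω, μ)`, in
nats. The base of the logarithm cancels in every ratio of entropies. -/
def entropy {Ω : Type*} [MeasurableSpace Ω] (μ : Measure Ω) {β : Type*} [Fintype β]
    (X : Ω → β) : ℝ :=
  ∑ b, Real.negMulLog (μ.real (X ⁻¹' {b}))

/-- The tuple `S_V = (S_i)_{i ∈ V}` as one random variable. -/
def tuple {Ω ι : Type*} {α : ι → Type*} (S : (i : ι) → Ω → α i) (V : Finset ι) :
    Ω → ((i : V) → α i) :=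
  fun ω i => S i ω

/-- `H(S_U | S_V) = H(S_{U ∪ V}) - H(S_V)`. -/
def condEntropy {Ω : Type*} [MeasurableSpace Ω] (μ : Measure Ω) {ι : Type*} [DecidableEq ι]
    {α : ι → Type*} [∀ i, Fintype (α i)] (S : (i : ι) → Ω → α i) (U V : Finset ι) : ℝ :=
  entropy μ (tuple S (U ∪ V)) - entropy μ (tuple S V)

/-- A family `(S_0, …, S_n)` is a perfect secret sharing scheme with secret `S_0` and shares
`S_1, …, S_n`, for the access structure on the parties `{1, …, n}` whose minimal qualified sets are
the members of `M`. -/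
structure IsPerfectScheme {Ω : Type*} [MeasurableSpace Ω] (μ : Measure Ω) {n : ℕ}
    {α : Fin (n + 1) → Type*} [∀ i, Fintype (α i)] (S : (i : Fin (n + 1)) → Ω → α i)
    (M : Set (Finset (Fin (n + 1)))) : Prop where
  correct : ∀ V ∈ M, condEntropy μ S {0} V = 0
  priv : ∀ V : Finset (Fin (n + 1)), 0 ∉ V → (∀ Q ∈ M, ¬ Q ⊆ V) →
    condEntropy μ S {0} V = entropy μ (S 0)

/-- The information ratio `max {H(S_1), …, H(S_n)} / H(S_0)` of a scheme with `n + 1 ≥ 1`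
parties. -/
def informationRatio {Ω : Type*} [MeasurableSpace Ω] (μ : Measure Ω) {n : ℕ}
    {α : Fin (n + 2) → Type*} [∀ i, Fintype (α i)] (S : (i : Fin (n + 2)) → Ω → α i) : ℝ :=
  (Finset.univ.sup' Finset.univ_nonempty
    fun i : Fin (n + 1) => entropy μ (S i.succ)) / entropy μ (S 0)

/-- The minimal qualified sets of the access structure `V_0` on the Vámos matroid, with parties
`{1, …, 7}`. -/
def vamosMinimalQualified : Set (Finset (Fin 8)) :=
  {V | V = {1, 2, 3} ∨ V = {1, 4, 5} ∨
    (0 ∉ V ∧ V.card = 4 ∧ ¬ {1, 2, 3} ⊆ V ∧ ¬ {1, 4, 5} ⊆ V ∧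
      V ≠ {2, 3, 4, 5} ∧ V ≠ {2, 3, 6, 7} ∧ V ≠ {4, 5, 6, 7})}

end SecretSharing

end

/-!
On the support of `(S₀, …, S₇)`, where all weights are positive, random variables become
partitions, joint variables become infima, and `x` determines `y` exactly when `x ≤ y`. Write `s`
for the secret, `a` for the share of party `1`, `b` and `c` for the joint shares of the parties
`2, 3` and `4, 5`, and `d` for that of `6, 7`. The bound `8 H(s) ≤ 7 max H(Sᵢ)` follows from
Shannon's inequalities after two applications of the copy lemma. First copy `(s, a)` to `(t, u)`
over `(b, c)`: both `s` and `t` are then common functions of the two sides, of `(a, b)`, `(a, c)`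
and of `(u, b)`, `(u, c)` respectively. Since `{2, 3, 4, 5}` is unqualified, `t` is independent of
all the original variables, so that `s` and `t` contribute two independent secrets on top of the
unqualified `{4, 5, 6, 7}` and `{2, 3, 6, 7}`. Then copy `(s, b)` over `(c, d, u)`: the copy of `b`
still determines `t` jointly with `u`, and the copy of `s` jointly with `d` and the share of party
`4` or `5`.
-/

noncomputable section

/-- A polymatroid on a semilattice of partitions (or random variables), where `x ⊓ y` stands for
the joint variable `(x, y)` and `x ≤ y` says that `x` determines `y`. -/
structure IsPolymatroid {L : Type*} [SemilatticeInf L] [OrderTop L] (H : L → ℝ) : Prop where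
  antitone : Antitone H
  submodular : ∀ {x y z : L}, x ≤ z → y ≤ z → H (x ⊓ y) + H z ≤ H x + H y
  map_top : H ⊤ = 0

/-- `(φ, ψ)` is a copy of `L` over `k`, in the sense of the copy lemma for Shannon entropy: `φ`
embeds the original variables and `ψ` their copies, which agree on the functions of `k` and are
conditionally independent of the originals given `k`. -/
structure IsCopy {L L' : Type*} [SemilatticeInf L] [SemilatticeInf L'] (H : L → ℝ) (H' : L' → ℝ)
    (k : L) (φ ψ : InfHom L L') : Prop where
  apply_fst : ∀ x, H' (φ x) = H x
  apply_snd : ∀ x, H' (ψ x) = H x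
  map_eq : ∀ {x}, k ≤ x → φ x = ψ x
  apply_inf : ∀ {x} (y), x ≤ k → H' (φ x ⊓ ψ y) = H x + H (k ⊓ y) - H k

/-- The conditional entropy `H(x | z)`. -/
def conditional {L : Type*} [SemilatticeInf L] (H : L → ℝ) (x z : L) : ℝ :=
  H (x ⊓ z) - H z

namespace IsPolymatroid

variable {L : Type*} [SemilatticeInf L] [OrderTop L] {H : L → ℝ}

theorem inf_le_add (hH : IsPolymatroid H) (x y : L) : H (x ⊓ y) ≤ H x + H y := by
  simpa only [hH.map_top, add_zero] using hH.submodular (le_top : x ≤ ⊤) (le_top : y ≤ ⊤)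

theorem apply_le (hH : IsPolymatroid H) (x y : L) (h : x ≤ y := by order) : H y ≤ H x :=
  hH.antitone h

theorem submodular_of_le (hH : IsPolymatroid H) (x y m z : L) (hm : x ⊓ y ≤ m := by order)
    (hx : x ≤ z := by order) (hy : y ≤ z := by order) : H m + H z ≤ H x + H y :=
  (add_le_add_left (hH.antitone hm) _).trans (hH.submodular hx hy)

-- In the inequalities below `t` and `u` play the role of copies of `s` and `a`, and `S` and `β`
-- that of copies of `s` and `b`; the hypotheses are the dependencies which survive the copying.
theorem common_information_le (hH : IsPolymatroid H) {b c d t u β : L} (hb : u ⊓ b ≤ t)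
    (hβ : u ⊓ β ≤ t) :
    H (d ⊓ t ⊓ u) + H (u ⊓ b ⊓ β) + H (c ⊓ u) + H (c ⊓ d ⊓ u ⊓ b ⊓ β) ≤
      H (d ⊓ u ⊓ b) + H (d ⊓ u ⊓ β) + H (c ⊓ u ⊓ b) + H (c ⊓ u ⊓ β) := by
  have h₁ := hH.submodular_of_le (d ⊓ u ⊓ b ⊓ β) (c ⊓ u ⊓ b ⊓ β) (c ⊓ d ⊓ u ⊓ b ⊓ β) (u ⊓ b ⊓ β)
  have h₂ := hH.submodular_of_le (c ⊓ u ⊓ b) (c ⊓ u ⊓ β) (c ⊓ u ⊓ b ⊓ β) (c ⊓ u)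
  have h₃ := hH.submodular_of_le (d ⊓ u ⊓ b) (d ⊓ u ⊓ β) (d ⊓ u ⊓ b ⊓ β) (d ⊓ t ⊓ u)
  linarith

theorem secret_share_le (hH : IsPolymatroid H) {s a b c u β : L} (hb : a ⊓ b ≤ s) (hc : a ⊓ c ≤ s) :
    H (s ⊓ a ⊓ β) + H (a ⊓ c ⊓ u ⊓ b ⊓ β) + H (u ⊓ β) ≤
      H (a ⊓ u) + H a + H (u ⊓ b ⊓ β) + H (c ⊓ β) + H β := by
  have h₁ := hH.submodular_of_le (a ⊓ u ⊓ b ⊓ β) (a ⊓ c ⊓ u ⊓ β) (a ⊓ c ⊓ u ⊓ b ⊓ β) (s ⊓ a ⊓ u ⊓ β)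
  have h₂ := hH.submodular_of_le (a ⊓ u ⊓ β) (u ⊓ b ⊓ β) (a ⊓ u ⊓ b ⊓ β) (u ⊓ β)
  have h₃ := hH.submodular_of_le (s ⊓ a ⊓ u ⊓ β) (a ⊓ c ⊓ β) (a ⊓ c ⊓ u ⊓ β) (s ⊓ a ⊓ β)
  have h₄ := hH.submodular_of_le (a ⊓ β) (c ⊓ β) (a ⊓ c ⊓ β) β
  have h₅ := hH.submodular_of_le (a ⊓ u) (a ⊓ β) (a ⊓ u ⊓ β) a
  have h₆ := hH.inf_le_add a β
  linarith

theorem secret_share_add_common_information_le (hH : IsPolymatroid H) {s a b c d t u β : L}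
    (hab : a ⊓ b ≤ s) (hac : a ⊓ c ≤ s)
    (hub : u ⊓ b ≤ t) (huβ : u ⊓ β ≤ t) :
    H (s ⊓ a ⊓ β) + H (d ⊓ t ⊓ u) + H (c ⊓ d ⊓ u ⊓ b ⊓ β) + H (a ⊓ c ⊓ d ⊓ u ⊓ b ⊓ β) +
        H (u ⊓ β) + H (c ⊓ u) + H (a ⊓ c ⊓ u ⊓ b) ≤
      H a + H (a ⊓ u) + H β + H (c ⊓ β) + H (c ⊓ u ⊓ β) + H (d ⊓ u ⊓ β) + H (c ⊓ u ⊓ b) +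
        H (d ⊓ u ⊓ b) + H (a ⊓ c ⊓ d ⊓ u ⊓ b) := by
  have h₁ := hH.common_information_le (c := c) (d := d) hub huβ
  have h₂ := hH.secret_share_le (u := u) (β := β) hab hac
  have h₃ := hH.submodular_of_le (a ⊓ c ⊓ d ⊓ u ⊓ b) (a ⊓ c ⊓ u ⊓ b ⊓ β) (a ⊓ c ⊓ d ⊓ u ⊓ b ⊓ β)
    (a ⊓ c ⊓ u ⊓ b)
  linarith

theorem conditional_add_conditional_le (hH : IsPolymatroid H) {s a c d S β C : L}
    (hcd : c ⊓ d ⊓ β ≤ S) (hC : β ≤ C) :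
    H β + conditional H S (d ⊓ β) + conditional H s (c ⊓ d ⊓ β) ≤
      H (s ⊓ a ⊓ β) + conditional H S (s ⊓ a ⊓ d ⊓ C) := by
  have h₁ := hH.submodular_of_le (s ⊓ a ⊓ β) (d ⊓ β) (s ⊓ a ⊓ d ⊓ β) β
  have h₂ := hH.submodular_of_le (S ⊓ (s ⊓ a ⊓ d ⊓ C)) (s ⊓ a ⊓ d ⊓ β) (s ⊓ a ⊓ d ⊓ S ⊓ β)
    (s ⊓ a ⊓ d ⊓ C)
  have h₃ := hH.apply_le (s ⊓ a ⊓ d ⊓ S ⊓ β) (s ⊓ d ⊓ S ⊓ β)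
  have h₄ := hH.submodular_of_le (s ⊓ d ⊓ S ⊓ β) (c ⊓ d ⊓ β) (s ⊓ (c ⊓ d ⊓ β)) (S ⊓ (d ⊓ β))
  unfold conditional
  linarith

theorem inf_add_determined_le (hH : IsPolymatroid H) {x y z e S : L} (hx : x ⊓ z ⊓ e ≤ S)
    (hy : y ⊓ z ⊓ e ≤ S) :
    H (x ⊓ y ⊓ z ⊓ e) + H (S ⊓ (z ⊓ e)) ≤
      conditional H x z + conditional H y z + 2 * H (z ⊓ e) := by
  have h₁ := hH.submodular_of_le (x ⊓ z ⊓ e) (y ⊓ z ⊓ e) (x ⊓ y ⊓ z ⊓ e) (S ⊓ (z ⊓ e))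
  have h₂ := hH.submodular_of_le (x ⊓ z) (z ⊓ e) (x ⊓ z ⊓ e) z
  have h₃ := hH.submodular_of_le (y ⊓ z) (z ⊓ e) (y ⊓ z ⊓ e) z
  unfold conditional
  linarith

theorem two_mul_conditional_determined_le (hH : IsPolymatroid H) {s a x y d t u S e : L}
    (hx : x ⊓ a ⊓ d ≤ s) (hy : y ⊓ a ⊓ d ≤ s) (hxe : x ⊓ d ⊓ e ≤ S) (hye : y ⊓ d ⊓ e ≤ S) :
    2 * (H (a ⊓ (x ⊓ y) ⊓ d ⊓ u ⊓ e) + conditional H S (s ⊓ a ⊓ d ⊓ e) + H (t ⊓ u)) ≤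
      conditional H x (s ⊓ a ⊓ d) + conditional H y (s ⊓ a ⊓ d) +
        conditional H x (a ⊓ d ⊓ t ⊓ u) + conditional H y (a ⊓ d ⊓ t ⊓ u) +
        2 * (H (a ⊓ (t ⊓ u)) + H (d ⊓ t ⊓ u ⊓ e)) := by
  have h₁ := hH.inf_add_determined_le (x := x) (y := y) (z := s ⊓ a ⊓ d) (e := e) (S := S)
    (by order) (by order)
  have h₂ := hH.inf_add_determined_le (x := x) (y := y) (z := a ⊓ d ⊓ t ⊓ u) (e := e) (S := s ⊓ S)
    (by order) (by order)
  have h₃ := hH.submodular_of_le (x ⊓ y ⊓ (s ⊓ a ⊓ d) ⊓ e) (s ⊓ S ⊓ (a ⊓ d ⊓ t ⊓ u ⊓ e))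
    (a ⊓ (x ⊓ y) ⊓ d ⊓ u ⊓ e) (S ⊓ (s ⊓ a ⊓ d ⊓ e))
  have h₄ := hH.apply_le (x ⊓ y ⊓ (a ⊓ d ⊓ t ⊓ u) ⊓ e) (a ⊓ (x ⊓ y) ⊓ d ⊓ u ⊓ e)
  have h₅ := hH.submodular_of_le (a ⊓ (t ⊓ u)) (d ⊓ t ⊓ u ⊓ e) (a ⊓ d ⊓ t ⊓ u ⊓ e) (t ⊓ u)
  unfold conditional at h₁ h₂ ⊢
  linarith

theorem sum_conditional_add_le (hH : IsPolymatroid H) {s a x y z v d t u : L}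
    (ht : u ⊓ (v ⊓ z) ≤ t) :
    conditional H x (s ⊓ a ⊓ d) + conditional H y (s ⊓ a ⊓ d) +
        conditional H x (a ⊓ d ⊓ t ⊓ u) + conditional H y (a ⊓ d ⊓ t ⊓ u) +
        2 * (H (d ⊓ t ⊓ u ⊓ z) - H (d ⊓ t ⊓ u) + conditional H a (t ⊓ u)) ≤
      2 * (conditional H x (s ⊓ a ⊓ d) + conditional H y (s ⊓ a ⊓ d) +
        conditional H z (s ⊓ a ⊓ d) + 2 * conditional H (s ⊓ a) (t ⊓ u) -
        conditional H s (d ⊓ u ⊓ (v ⊓ z))) := by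
  have h₁ := hH.submodular_of_le (x ⊓ (s ⊓ a ⊓ d)) (s ⊓ a ⊓ d ⊓ t ⊓ u) (x ⊓ (a ⊓ d ⊓ t ⊓ u))
    (s ⊓ a ⊓ d)
  have h₂ := hH.submodular_of_le (y ⊓ (s ⊓ a ⊓ d)) (s ⊓ a ⊓ d ⊓ t ⊓ u) (y ⊓ (a ⊓ d ⊓ t ⊓ u))
    (s ⊓ a ⊓ d)
  have h₃ := hH.submodular_of_le (z ⊓ (s ⊓ a ⊓ d)) (s ⊓ a ⊓ d ⊓ t ⊓ u) (z ⊓ (s ⊓ a ⊓ d ⊓ t ⊓ u))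
    (s ⊓ a ⊓ d)
  have h₄ := hH.submodular_of_le (s ⊓ d ⊓ t ⊓ u ⊓ z) (d ⊓ u ⊓ (v ⊓ z)) (s ⊓ (d ⊓ u ⊓ (v ⊓ z)))
    (d ⊓ t ⊓ u ⊓ z)
  have h₅ := hH.apply_le (z ⊓ (s ⊓ a ⊓ d ⊓ t ⊓ u)) (s ⊓ d ⊓ t ⊓ u ⊓ z)
  have h₆ := hH.submodular_of_le (s ⊓ a ⊓ (t ⊓ u)) (a ⊓ d ⊓ t ⊓ u) (s ⊓ a ⊓ d ⊓ t ⊓ u) (a ⊓ (t ⊓ u))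
  have h₇ := hH.submodular_of_le (a ⊓ (t ⊓ u)) (d ⊓ t ⊓ u) (a ⊓ d ⊓ t ⊓ u) (t ⊓ u)
  unfold conditional
  linarith

theorem parallel_determined_le (hH : IsPolymatroid H) {s a b c t u : L}
    (hab : a ⊓ b ≤ s) (hac : a ⊓ c ≤ s) (hub : u ⊓ b ≤ t) (huc : c ⊓ u ≤ t) :
    H (s ⊓ a ⊓ (t ⊓ u)) + H (a ⊓ c ⊓ u ⊓ b) + 2 * H u ≤
      2 * H (a ⊓ u) + H (u ⊓ b) + H (c ⊓ u) := by
  have h₁ := hH.submodular_of_le (a ⊓ u ⊓ b) (a ⊓ c ⊓ u) (a ⊓ c ⊓ u ⊓ b) (s ⊓ a ⊓ (t ⊓ u))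
  have h₂ := hH.submodular_of_le (a ⊓ u) (u ⊓ b) (a ⊓ u ⊓ b) u
  have h₃ := hH.submodular_of_le (a ⊓ u) (c ⊓ u) (a ⊓ c ⊓ u) u
  linarith

end IsPolymatroid

namespace IsCopy

variable {L L' : Type*} [SemilatticeInf L] [SemilatticeInf L'] {H : L → ℝ} {H' : L' → ℝ} {k : L}
  {φ ψ : InfHom L L'}

theorem apply_inf_of_le (hc : IsCopy H H' k φ ψ) {x : L} (hx : k ≤ x) (y : L) :
    H' (φ x ⊓ ψ y) = H (x ⊓ y) := by
  rw [hc.map_eq hx, ← map_inf, hc.apply_snd]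

theorem conditional_fst (hc : IsCopy H H' k φ ψ) (x y : L) :
    conditional H' (φ x) (φ y) = conditional H x y := by
  simp only [conditional, ← map_inf, hc.apply_fst]

theorem apply_inf_inf {x y z : L} (hc : IsCopy H H' k φ ψ) (h : x ⊓ z ≤ k) :
    H' (φ x ⊓ ψ y ⊓ φ z) = H (x ⊓ z) + H (k ⊓ y) - H k := by
  rw [inf_right_comm, ← map_inf, hc.apply_inf y h]

variable [OrderTop L']

theorem add_two_mul_secret_le {s y : L} (hc : IsCopy H H' k φ ψ) (hH' : IsPolymatroid H')
    (hdet : k ⊓ y ≤ s) (hk : H (s ⊓ k) = H k + H s) (hy : H (s ⊓ y) = H y + H s) :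
    H y + 2 * H s ≤ H' (φ s ⊓ φ y ⊓ ψ s) := by
  have h := hH'.submodular_of_le (φ (s ⊓ y) ⊓ ψ s) (φ (k ⊓ y)) (φ (k ⊓ y) ⊓ ψ s) (φ (s ⊓ y))
    (by order) (by order) (OrderHomClass.mono φ (by order : k ⊓ y ≤ s ⊓ y))
  rw [hc.apply_inf s inf_le_left, hc.apply_fst, hc.apply_fst, inf_comm k s, hk, hy,
    map_inf φ s] at h
  linarith

theorem secret_share_add_common_information_le {s a b c d t u : L}
    (hc : IsCopy H H' (c ⊓ d ⊓ u) φ ψ) (hH' : IsPolymatroid H')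
    (hab : a ⊓ b ≤ s) (hac : a ⊓ c ≤ s) (hub : u ⊓ b ≤ t) (ht : c ⊓ d ⊓ u ≤ t) :
    H' (φ s ⊓ φ a ⊓ ψ b) + H (d ⊓ t ⊓ u) + 3 * H (c ⊓ d ⊓ u ⊓ b) + H (u ⊓ b) + H (c ⊓ u) +
        H (a ⊓ c ⊓ u ⊓ b) ≤
      H a + H (a ⊓ u) + H b + H (c ⊓ b) + 2 * H (c ⊓ u ⊓ b) + 2 * H (d ⊓ u ⊓ b) +
        2 * H (c ⊓ d ⊓ u) := by
  have huψ : φ u ⊓ ψ b ≤ φ t := by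
    rw [hc.map_eq ht, hc.map_eq inf_le_right, ← map_inf]
    exact OrderHomClass.mono ψ hub
  have h := hH'.secret_share_add_common_information_le (s := φ s) (a := φ a) (b := φ b) (c := φ c)
    (d := φ d) (t := φ t) (u := φ u)
    (β := ψ b) (by simpa only [← map_inf] using OrderHomClass.mono φ hab)
    (by simpa only [← map_inf] using OrderHomClass.mono φ hac)
    (by simpa only [← map_inf] using OrderHomClass.mono φ hub) huψ
  simp only [← map_inf, hc.apply_fst, hc.apply_snd] at h ⊢
  rw [hc.apply_inf b (by order : c ⊓ d ⊓ u ⊓ b ≤ c ⊓ d ⊓ u),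
    hc.apply_inf b (by order : a ⊓ c ⊓ d ⊓ u ⊓ b ≤ c ⊓ d ⊓ u),
    hc.apply_inf_of_le (by order : c ⊓ d ⊓ u ≤ u), hc.apply_inf_of_le (by order : c ⊓ d ⊓ u ≤ c),
    hc.apply_inf_of_le (by order : c ⊓ d ⊓ u ≤ c ⊓ u),
    hc.apply_inf_of_le (by order : c ⊓ d ⊓ u ≤ d ⊓ u)] at h
  linarith

theorem conditional_add_conditional_le {s a b c d u x : L} (hc : IsCopy H H' (c ⊓ d ⊓ u) φ ψ)
    (hH' : IsPolymatroid H')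
    (hcd : c ⊓ d ⊓ b ≤ s) (hx : b ≤ x) :
    H b + conditional H s (d ⊓ b) + (H (s ⊓ c ⊓ d) - H (c ⊓ d ⊓ b)) +
        conditional H b (c ⊓ d ⊓ u) ≤
      H' (φ s ⊓ φ a ⊓ ψ b) + conditional H' (ψ s) (φ s ⊓ φ a ⊓ φ d ⊓ ψ x) := by
  have hφ {y : L} (hy : c ⊓ d ⊓ u ≤ y) := hc.apply_inf_of_le hy b
  have hcdψ : φ c ⊓ φ d ⊓ ψ b ≤ ψ s := by
    rw [hc.map_eq (by order : c ⊓ d ⊓ u ≤ c), hc.map_eq (by order : c ⊓ d ⊓ u ≤ d)]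
    simpa only [map_inf] using OrderHomClass.mono ψ hcd
  have h₁ := hH'.conditional_add_conditional_le (s := φ s) (a := φ a) hcdψ (OrderHomClass.mono ψ hx)
  have h₂ := hH'.submodular_of_le (φ (s ⊓ c ⊓ d ⊓ u)) (φ s ⊓ (φ c ⊓ φ d ⊓ ψ b))
    (φ (s ⊓ c ⊓ d ⊓ u) ⊓ ψ b) (φ (s ⊓ c ⊓ d)) (by simp only [map_inf]; order)
    (by simp only [map_inf]; order) (by simp only [map_inf]; order)
  have h₃ : ψ s ⊓ (φ d ⊓ ψ b) = ψ (s ⊓ (d ⊓ b)) := by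
    rw [hc.map_eq (by order : c ⊓ d ⊓ u ≤ d), map_inf, map_inf]
  rw [hc.apply_inf b (by order : s ⊓ c ⊓ d ⊓ u ≤ c ⊓ d ⊓ u), hc.apply_fst, hc.apply_fst] at h₂
  rw [conditional, h₃, conditional, hc.apply_snd, hc.apply_snd, hφ (by order), ← map_inf φ c,
    hφ (by order), map_inf φ c] at h₁
  rw [conditional, conditional, inf_comm b]
  linarith

theorem two_mul_conditional_determined_le {s a x y z d t u : L}
    (hc : IsCopy H H' (x ⊓ y ⊓ d ⊓ u) φ ψ) (hH' : IsPolymatroid H')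
    (hx : x ⊓ a ⊓ d ≤ s) (hy : y ⊓ a ⊓ d ≤ s) (hxz : x ⊓ d ⊓ z ≤ s) (hyz : y ⊓ d ⊓ z ≤ s)
    (ht : x ⊓ y ⊓ d ⊓ u ≤ t) :
    2 * (H (a ⊓ (x ⊓ y) ⊓ d ⊓ u) + conditional H z (x ⊓ y ⊓ d ⊓ u) +
        conditional H' (ψ s) (φ s ⊓ φ a ⊓ φ d ⊓ ψ z) + H (t ⊓ u)) ≤
      conditional H x (s ⊓ a ⊓ d) + conditional H y (s ⊓ a ⊓ d) +
        conditional H x (a ⊓ d ⊓ t ⊓ u) + conditional H y (a ⊓ d ⊓ t ⊓ u) +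
        2 * (H (a ⊓ (t ⊓ u)) + H (d ⊓ t ⊓ u ⊓ z)) := by
  have hψ {w : L} (hw : x ⊓ y ⊓ d ⊓ u ≤ w) (hwz : w ⊓ d ⊓ z ≤ s) : φ w ⊓ φ d ⊓ ψ z ≤ ψ s := by
    rw [hc.map_eq hw, hc.map_eq (by order : x ⊓ y ⊓ d ⊓ u ≤ d)]
    simpa only [map_inf] using OrderHomClass.mono ψ hwz
  have h := hH'.two_mul_conditional_determined_le (s := φ s) (a := φ a) (x := φ x) (y := φ y)
    (d := φ d) (t := φ t) (u := φ u)
    (by simpa only [← map_inf] using OrderHomClass.mono φ hx)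
    (by simpa only [← map_inf] using OrderHomClass.mono φ hy)
    (hψ (by order) hxz) (hψ (by order) hyz)
  simp only [← map_inf, hc.apply_fst, hc.conditional_fst] at h ⊢
  rw [hc.apply_inf z (by order : a ⊓ (x ⊓ y) ⊓ d ⊓ u ≤ x ⊓ y ⊓ d ⊓ u),
    hc.apply_inf_of_le (by order : x ⊓ y ⊓ d ⊓ u ≤ d ⊓ t ⊓ u)] at h
  rw [conditional.eq_def H z, inf_comm z]
  linarith

theorem second_copy_inequality {s a x₂ x₃ x₄ x₅ d t u : L} [OrderTop L] (hH : IsPolymatroid H)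
    (hH' : IsPolymatroid H') (hc : IsCopy H H' (x₄ ⊓ x₅ ⊓ d ⊓ u) φ ψ)
    (h₁₂₃ : a ⊓ (x₂ ⊓ x₃) ≤ s) (h₁₄₅ : a ⊓ (x₄ ⊓ x₅) ≤ s)
    (h₁₄ : x₄ ⊓ a ⊓ d ≤ s) (h₁₅ : x₅ ⊓ a ⊓ d ≤ s)
    (h₃₄ : x₄ ⊓ d ⊓ x₃ ≤ s) (h₃₅ : x₅ ⊓ d ⊓ x₃ ≤ s)
    (ht₂₃ : u ⊓ (x₂ ⊓ x₃) ≤ t) (ht₄₅ : x₄ ⊓ x₅ ⊓ u ≤ t) :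
    4 * H (x₄ ⊓ x₅ ⊓ d ⊓ u ⊓ (x₂ ⊓ x₃)) + 3 * H (a ⊓ (x₄ ⊓ x₅) ⊓ u ⊓ (x₂ ⊓ x₃)) +
        conditional H s (d ⊓ (x₂ ⊓ x₃)) + H (s ⊓ (x₄ ⊓ x₅) ⊓ d) + H (a ⊓ (x₄ ⊓ x₅) ⊓ d ⊓ u) +
        H (x₃ ⊓ (x₄ ⊓ x₅ ⊓ d ⊓ u)) + 2 * H (t ⊓ u) + H (s ⊓ (d ⊓ u ⊓ (x₂ ⊓ x₃))) + 4 * H u ≤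
      H a + 5 * H (a ⊓ u) + H (x₄ ⊓ x₅ ⊓ (x₂ ⊓ x₃)) + 2 * H (x₄ ⊓ x₅ ⊓ u ⊓ (x₂ ⊓ x₃)) +
        3 * H (d ⊓ u ⊓ (x₂ ⊓ x₃)) + 4 * H (x₄ ⊓ x₅ ⊓ d ⊓ u) + H (x₄ ⊓ x₅ ⊓ d ⊓ (x₂ ⊓ x₃)) +
        H (u ⊓ (x₂ ⊓ x₃)) + H (x₄ ⊓ x₅ ⊓ u) + (conditional H x₃ (s ⊓ a ⊓ d) +
        conditional H x₄ (s ⊓ a ⊓ d) + conditional H x₅ (s ⊓ a ⊓ d)) := by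
  have hA := hc.secret_share_add_common_information_le hH' h₁₂₃ h₁₄₅ ht₂₃ (by order)
  have hB := hc.conditional_add_conditional_le (s := s) (a := a) (b := x₂ ⊓ x₃) (x := x₃) hH'
    (by order) inf_le_right
  have hC := hc.two_mul_conditional_determined_le hH' h₁₄ h₁₅ h₃₄ h₃₅ (t := t) (by order)
  have hD := hH.sum_conditional_add_le (s := s) (a := a) (x := x₄) (y := x₅) (d := d) ht₂₃
  have hE := hH.parallel_determined_le h₁₂₃ h₁₄₅ ht₂₃ ht₄₅
  rw [conditional.eq_def H (x₂ ⊓ x₃), inf_comm (x₂ ⊓ x₃)] at hB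
  rw [conditional.eq_def H x₃ (x₄ ⊓ x₅ ⊓ d ⊓ u)] at hC
  rw [conditional.eq_def H a, conditional.eq_def H (s ⊓ a),
    conditional.eq_def H s (d ⊓ u ⊓ (x₂ ⊓ x₃))] at hD
  linarith

end IsCopy

/-- The access structure `V₀` in terms of partitions: `s` is the secret, `a`, `x₂`, `x₃`, `x₄`,
`x₅` are the shares of the parties `1, …, 5`, and `d` is the joint share of the parties `6` and
`7`. Only the qualified and unqualified sets which the bound relies on are recorded. -/
structure IsVamosPort {L : Type*} [SemilatticeInf L] (H : L → ℝ) (s a x₂ x₃ x₄ x₅ d : L) :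
    Prop where
  det₁₂₃ : a ⊓ (x₂ ⊓ x₃) ≤ s
  det₁₄₅ : a ⊓ (x₄ ⊓ x₅) ≤ s
  det₁₃ : x₃ ⊓ a ⊓ d ≤ s
  det₁₄ : x₄ ⊓ a ⊓ d ≤ s
  det₁₅ : x₅ ⊓ a ⊓ d ≤ s
  det₃₄ : x₄ ⊓ d ⊓ x₃ ≤ s
  det₃₅ : x₅ ⊓ d ⊓ x₃ ≤ s
  indep₁ : H (s ⊓ a) = H a + H s
  indep₁₆₇ : H (s ⊓ (a ⊓ d)) = H (a ⊓ d) + H s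
  indep₂₃₄₅ : H (s ⊓ (x₄ ⊓ x₅ ⊓ (x₂ ⊓ x₃))) = H (x₄ ⊓ x₅ ⊓ (x₂ ⊓ x₃)) + H s
  indep₂₃₆₇ : H (s ⊓ (d ⊓ (x₂ ⊓ x₃))) = H (d ⊓ (x₂ ⊓ x₃)) + H s
  indep₄₅₆₇ : H (s ⊓ (x₄ ⊓ x₅ ⊓ d)) = H (x₄ ⊓ x₅ ⊓ d) + H s

namespace IsVamosPort

variable {L L' L'' : Type*} [SemilatticeInf L] [SemilatticeInf L'] [OrderTop L']
  [SemilatticeInf L''] [OrderTop L''] {H : L → ℝ} {H' : L' → ℝ} {H'' : L'' → ℝ}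
  {φ ψ : InfHom L L'} {φ' ψ' : InfHom L' L''} {s a x₂ x₃ x₄ x₅ d : L}

theorem conditional_le [OrderTop L] (hH : IsPolymatroid H)
    (hV : IsVamosPort H s a x₂ x₃ x₄ x₅ d) {x : L} (hx : x ⊓ a ⊓ d ≤ s) :
    conditional H x (s ⊓ a ⊓ d) ≤ H x - H s := by
  have h₁ := hH.inf_le_add x (a ⊓ d)
  have h₂ := hH.apply_le (x ⊓ (a ⊓ d)) (x ⊓ (s ⊓ (a ⊓ d)))
  rw [conditional, inf_assoc s, hV.indep₁₆₇]
  linarith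

theorem first_copy_lower_bounds (hH' : IsPolymatroid H') (hV : IsVamosPort H s a x₂ x₃ x₄ x₅ d)
    (hc : IsCopy H H' (x₄ ⊓ x₅ ⊓ (x₂ ⊓ x₃)) φ ψ) :
    H (x₄ ⊓ x₅ ⊓ d) + 2 * H s ≤ H' (φ (a ⊓ (x₄ ⊓ x₅) ⊓ d) ⊓ ψ a) ∧
      H (x₄ ⊓ x₅ ⊓ d) + 2 * H s ≤ H' (φ x₃ ⊓ (φ (x₄ ⊓ x₅ ⊓ d) ⊓ ψ a)) ∧
      H (d ⊓ (x₂ ⊓ x₃)) + 2 * H s ≤ H' (φ s ⊓ (φ d ⊓ ψ a ⊓ φ (x₂ ⊓ x₃))) := by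
  have hcd := hc.add_two_mul_secret_le hH' (y := x₄ ⊓ x₅ ⊓ d) (by have := hV.det₃₄; order)
    hV.indep₂₃₄₅ hV.indep₄₅₆₇
  have hbd := hc.add_two_mul_secret_le hH' (y := d ⊓ (x₂ ⊓ x₃)) (by have := hV.det₃₄; order)
    hV.indep₂₃₄₅ hV.indep₂₃₆₇
  have hψc : φ (x₄ ⊓ x₅) ⊓ ψ a ≤ ψ s := by
    rw [hc.map_eq inf_le_left, ← map_inf]
    exact OrderHomClass.mono ψ (by have := hV.det₁₄₅; order)
  have hψb : φ (x₂ ⊓ x₃) ⊓ ψ a ≤ ψ s := by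
    rw [hc.map_eq inf_le_right, ← map_inf]
    exact OrderHomClass.mono ψ (by have := hV.det₁₂₃; order)
  have hφac : φ a ⊓ φ (x₄ ⊓ x₅) ≤ φ s := by
    simpa only [← map_inf] using OrderHomClass.mono φ hV.det₁₄₅
  have hφ₃cd : φ x₃ ⊓ (φ (x₄ ⊓ x₅) ⊓ φ d) ≤ φ s := by
    simpa only [← map_inf] using
      OrderHomClass.mono φ (by have := hV.det₃₄; order : x₃ ⊓ (x₄ ⊓ x₅ ⊓ d) ≤ s)
  simp only [map_inf φ (_ ⊓ _) d, map_inf φ a, map_inf φ d] at hcd hbd ⊢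
  exact ⟨hcd.trans (hH'.apply_le _ _), hcd.trans (hH'.apply_le _ _), hbd.trans (hH'.apply_le _ _)⟩

theorem first_copy_upper_bound (hH' : IsPolymatroid H')
    (hc : IsCopy H H' (x₄ ⊓ x₅ ⊓ (x₂ ⊓ x₃)) φ ψ) :
    5 * H' (φ a ⊓ ψ a) + 3 * H' (φ d ⊓ ψ a ⊓ φ (x₂ ⊓ x₃)) + 4 * H' (φ (x₄ ⊓ x₅ ⊓ d) ⊓ ψ a) ≤
      14 * H a + 3 * H (d ⊓ (x₂ ⊓ x₃)) + 3 * H (a ⊓ (x₂ ⊓ x₃)) - 3 * H (x₂ ⊓ x₃) +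
        4 * H (x₄ ⊓ x₅ ⊓ d) := by
  have hb : φ (x₂ ⊓ x₃) = ψ (x₂ ⊓ x₃) := hc.map_eq inf_le_right
  have h₁ := hH'.inf_le_add (φ a) (ψ a)
  have h₂ := hH'.submodular_of_le (φ (d ⊓ (x₂ ⊓ x₃))) (ψ (a ⊓ (x₂ ⊓ x₃))) (φ d ⊓ ψ a ⊓ φ (x₂ ⊓ x₃))
    (φ (x₂ ⊓ x₃)) (by rw [map_inf φ d, map_inf ψ a]; order) (by rw [map_inf φ d]; order)
    (by rw [map_inf ψ a]; order)
  have h₃ := hH'.inf_le_add (φ (x₄ ⊓ x₅ ⊓ d)) (ψ a)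
  simp only [hc.apply_fst, hc.apply_snd] at h₁ h₂ h₃
  linarith

theorem share_inequality [OrderTop L] (hH : IsPolymatroid H) (hH' : IsPolymatroid H')
    (hH'' : IsPolymatroid H'') (hV : IsVamosPort H s a x₂ x₃ x₄ x₅ d)
    (hc : IsCopy H H' (x₄ ⊓ x₅ ⊓ (x₂ ⊓ x₃)) φ ψ)
    (hc' : IsCopy H' H'' (φ x₄ ⊓ φ x₅ ⊓ φ d ⊓ ψ a) φ' ψ') :
    3 * H (x₄ ⊓ x₅ ⊓ d ⊓ (x₂ ⊓ x₃)) + 8 * conditional H a (x₄ ⊓ x₅ ⊓ (x₂ ⊓ x₃)) + 13 * H s ≤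
      9 * H a + 2 * H (d ⊓ (x₂ ⊓ x₃)) + H (x₄ ⊓ x₅ ⊓ d) + 4 * H (a ⊓ (x₂ ⊓ x₃)) -
        3 * H (x₂ ⊓ x₃) + H (a ⊓ (x₄ ⊓ x₅)) + H x₃ + H x₄ + H x₅ := by
  have hφ {x y : L} (h : x ≤ y) := OrderHomClass.mono φ h
  have hb : φ x₂ ⊓ φ x₃ = ψ (x₂ ⊓ x₃) := by rw [← map_inf]; exact hc.map_eq inf_le_right
  have hc₄₅ : φ x₄ ⊓ φ x₅ = ψ (x₄ ⊓ x₅) := by rw [← map_inf]; exact hc.map_eq inf_le_left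
  have h := hc'.second_copy_inequality hH' hH'' (s := φ s) (a := φ a) (x₂ := φ x₂) (x₃ := φ x₃)
    (t := ψ s) (by simpa only [← map_inf] using hφ hV.det₁₂₃)
    (by simpa only [← map_inf] using hφ hV.det₁₄₅)
    (by simpa only [← map_inf] using hφ hV.det₁₄) (by simpa only [← map_inf] using hφ hV.det₁₅)
    (by simpa only [← map_inf] using hφ hV.det₃₄) (by simpa only [← map_inf] using hφ hV.det₃₅)
    (by rw [hb, ← map_inf]; exact OrderHomClass.mono ψ hV.det₁₂₃)
    (by rw [hc₄₅, ← map_inf, inf_comm]; exact OrderHomClass.mono ψ hV.det₁₄₅)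
  simp only [← map_inf, hc.apply_fst, hc.apply_snd, hc.conditional_fst] at h
  rw [hc.apply_inf_inf (by order : x₄ ⊓ x₅ ⊓ d ⊓ (x₂ ⊓ x₃) ≤ x₄ ⊓ x₅ ⊓ (x₂ ⊓ x₃)),
    hc.apply_inf_inf (by order : a ⊓ (x₄ ⊓ x₅) ⊓ (x₂ ⊓ x₃) ≤ x₄ ⊓ x₅ ⊓ (x₂ ⊓ x₃)),
    hc.apply_inf_inf le_rfl, hc.apply_inf_of_le inf_le_left, inf_comm (ψ a),
    hc.apply_inf_of_le inf_le_right, hV.indep₁, inf_comm (x₂ ⊓ x₃) a, inf_comm (x₄ ⊓ x₅) a] at h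
  obtain ⟨hacda, hcda, hbda⟩ := hV.first_copy_lower_bounds hH' hc
  have hupper := first_copy_upper_bound (d := d) (a := a) hH' hc
  have h₃ := hV.conditional_le hH hV.det₁₃
  have h₄ := hV.conditional_le hH hV.det₁₄
  have h₅ := hV.conditional_le hH hV.det₁₅
  have hsdb : conditional H s (d ⊓ (x₂ ⊓ x₃)) = H s := by
    rw [conditional, hV.indep₂₃₆₇, add_sub_cancel_left]
  have hacb : H (a ⊓ (x₄ ⊓ x₅) ⊓ (x₂ ⊓ x₃)) = H (x₄ ⊓ x₅ ⊓ (x₂ ⊓ x₃) ⊓ a) := by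
    rw [inf_assoc a, inf_comm a]
  rw [conditional, inf_comm a]
  rw [inf_assoc s, hV.indep₄₅₆₇] at h
  linarith

theorem eight_mul_secret_le [OrderTop L] {ρ : ℝ}
    (hH : IsPolymatroid H) (hH' : IsPolymatroid H')
    (hH'' : IsPolymatroid H'') (hV : IsVamosPort H s a x₂ x₃ x₄ x₅ d)
    (hc : IsCopy H H' (x₄ ⊓ x₅ ⊓ (x₂ ⊓ x₃)) φ ψ)
    (hc' : IsCopy H' H'' (φ x₄ ⊓ φ x₅ ⊓ φ d ⊓ ψ a) φ' ψ')
    (ha : H a ≤ ρ) (h₂ : H x₂ ≤ ρ) (h₃ : H x₃ ≤ ρ) (h₄ : H x₄ ≤ ρ) (h₅ : H x₅ ≤ ρ) :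
    8 * H s ≤ 7 * ρ := by
  have h := hV.share_inequality hH hH' hH'' hc hc'
  have hcd := hH.apply_le (x₄ ⊓ x₅ ⊓ d ⊓ (x₂ ⊓ x₃)) (s ⊓ (x₄ ⊓ x₅ ⊓ d))
    (by have := hV.det₃₄; order)
  have hbd := hH.apply_le (x₄ ⊓ x₅ ⊓ d ⊓ (x₂ ⊓ x₃)) (s ⊓ (d ⊓ (x₂ ⊓ x₃)))
    (by have := hV.det₃₄; order)
  have ha_bc := hH.apply_le (a ⊓ (x₄ ⊓ x₅ ⊓ (x₂ ⊓ x₃))) (s ⊓ (x₄ ⊓ x₅ ⊓ (x₂ ⊓ x₃)))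
    (by have := hV.det₁₂₃; order)
  have hab := hH.inf_le_add a (x₂ ⊓ x₃)
  have hac := hH.inf_le_add a (x₄ ⊓ x₅)
  have hb := hH.inf_le_add x₂ x₃
  have hc₄₅ := hH.inf_le_add x₄ x₅
  rw [hV.indep₄₅₆₇] at hcd
  rw [hV.indep₂₃₆₇] at hbd
  rw [hV.indep₂₃₄₅] at ha_bc
  unfold conditional at h
  linarith

end IsVamosPort

section PartitionEntropy

open scoped Classical

variable {Ω Ω' : Type*} [Fintype Ω] [Fintype Ω']

/-- The total weight of the class of `ω` in the partition `r`. -/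
def classMass (p : Ω → ℝ) (r : Setoid Ω) (ω : Ω) : ℝ :=
  ∑ x with r ω x, p x

/-- The Shannon entropy of a partition of a finite set with weights `p`. -/
def partitionEntropy (p : Ω → ℝ) (r : Setoid Ω) : ℝ :=
  -∑ ω, p ω * Real.log (classMass p r ω)

variable {p : Ω → ℝ} {q : Ω' → ℝ} {k r u v : Setoid Ω}

theorem classMass_congr {x y : Ω} (h : r x y) : classMass p r x = classMass p r y :=
  Finset.sum_congr (Finset.filter_congr fun _ _ => ⟨r.trans (r.symm h), r.trans h⟩) fun _ _ => rfl

theorem classMass_top (hp : ∑ ω, p ω = 1) (ω : Ω) : classMass p ⊤ ω = 1 := by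
  rw [classMass, Finset.filter_true_of_mem, hp]
  exact fun _ _ => trivial

theorem classMass_pos (hp : ∀ ω, 0 < p ω) (r : Setoid Ω) (ω : Ω) : 0 < classMass p r ω :=
  Finset.sum_pos (fun x _ => hp x) ⟨ω, Finset.mem_filter.2 ⟨Finset.mem_univ ω, r.refl ω⟩⟩

theorem classMass_mono (hp : ∀ ω, 0 < p ω) (h : u ≤ v) (ω : Ω) :
    classMass p u ω ≤ classMass p v ω :=
  Finset.sum_le_sum_of_subset_of_nonneg (Finset.monotone_filter_right _ fun _ _ hx => h hx)
    fun x _ _ => (hp x).le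

theorem sum_div_classMass (hp : ∀ ω, 0 < p ω) (r : Setoid Ω) (ω : Ω) :
    ∑ x with r ω x, p x / classMass p r x = 1 := by
  rw [← div_self (classMass_pos hp r ω).ne', classMass, Finset.sum_div]
  refine Finset.sum_congr rfl fun x hx => ?_
  rw [← classMass_congr (Finset.mem_filter.1 hx).2, classMass]

theorem partitionEntropy_strictAnti (hp : ∀ ω, 0 < p ω) : StrictAnti (partitionEntropy p) := by
  intro u v huv
  obtain ⟨x, y, hv, hu⟩ : ∃ x y, v x y ∧ ¬ u x y := by
    by_contra! h
    exact huv.not_ge fun {x y} => h x y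
  have hlog (ω : Ω) : Real.log (classMass p u ω) ≤ Real.log (classMass p v ω) :=
    Real.log_le_log (classMass_pos hp u ω) (classMass_mono hp huv.le ω)
  refine neg_lt_neg (Finset.sum_lt_sum
    (fun ω _ => mul_le_mul_of_nonneg_left (hlog ω) (hp ω).le) ⟨x, Finset.mem_univ x, ?_⟩)
  refine mul_lt_mul_of_pos_left (Real.log_lt_log (classMass_pos hp u x) ?_) (hp x)
  exact Finset.sum_lt_sum_of_subset (Finset.monotone_filter_right _ fun _ _ h => huv.le h)
    (Finset.mem_filter.2 ⟨Finset.mem_univ y, hv⟩) (fun h => hu (Finset.mem_filter.1 h).2) (hp y)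
    fun z _ _ => (hp z).le

theorem le_of_partitionEntropy_inf_eq (hp : ∀ ω, 0 < p ω)
    (h : partitionEntropy p (u ⊓ v) = partitionEntropy p v) : v ≤ u :=
  inf_eq_right.1 (inf_le_right.eq_of_not_lt fun hlt =>
    (partitionEntropy_strictAnti hp hlt).ne' h)

theorem sum_class_mul_classMass_le (hp : ∀ ω, 0 < p ω) (hu : u ≤ k) (hv : v ≤ k) (y : Ω) :
    ∑ ω with v y ω, p ω / classMass p (u ⊓ v) ω * classMass p u ω ≤ classMass p k y := by
  have hclass (x : Ω) : ∑ ω with v y ω ∧ u x ω, p ω / classMass p (u ⊓ v) ω ≤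
      if k y x then 1 else 0 := by
    by_cases h : ∃ z, v y z ∧ u x z
    · obtain ⟨z, hyz, hxz⟩ := h
      rw [if_pos (k.trans (hv hyz) (k.symm (hu hxz))), ← sum_div_classMass hp (u ⊓ v) z]
      refine (Finset.sum_congr (Finset.filter_congr fun ω _ => ?_) fun _ _ => rfl).le
      exact ⟨fun hω => ⟨u.trans (u.symm hxz) hω.2, v.trans (v.symm hyz) hω.1⟩,
        fun hω => ⟨v.trans hyz hω.2, u.trans hxz hω.1⟩⟩
    · push Not at h
      rw [Finset.filter_false_of_mem fun ω _ hω => h ω hω.1 hω.2, Finset.sum_empty]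
      split_ifs <;> norm_num
  calc ∑ ω with v y ω, p ω / classMass p (u ⊓ v) ω * classMass p u ω
      = ∑ x, p x * ∑ ω with v y ω ∧ u x ω, p ω / classMass p (u ⊓ v) ω := by
        simp only [classMass, Finset.mul_sum]
        rw [Finset.sum_comm' (t' := Finset.univ)
          (s' := fun x => Finset.univ.filter fun ω => v y ω ∧ u x ω)]
        · simp only [mul_comm]
        · simp only [Finset.mem_filter, Finset.mem_univ, true_and, u.comm', and_true, implies_true]
    _ ≤ ∑ x, p x * if k y x then 1 else 0 :=
        Finset.sum_le_sum fun x _ => mul_le_mul_of_nonneg_left (hclass x) (hp x).le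
    _ = classMass p k y := by simp only [mul_ite, mul_one, mul_zero, ← Finset.sum_filter, classMass]

theorem sum_mul_classMass_le (hp : ∀ ω, 0 < p ω) (hu : u ≤ k) (hv : v ≤ k) :
    ∑ ω, p ω * (classMass p u ω * classMass p v ω / (classMass p (u ⊓ v) ω * classMass p k ω)) ≤
      ∑ ω, p ω := by
  calc ∑ ω, p ω * (classMass p u ω * classMass p v ω / (classMass p (u ⊓ v) ω * classMass p k ω))
      = ∑ ω, ∑ y with v ω y,
          p y * (p ω / classMass p (u ⊓ v) ω * classMass p u ω / classMass p k ω) := by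
        refine Finset.sum_congr rfl fun ω _ => ?_
        rw [← Finset.sum_mul, ← classMass]
        ring
    _ = ∑ y, ∑ ω with v y ω,
          p y * (p ω / classMass p (u ⊓ v) ω * classMass p u ω / classMass p k ω) :=
        Finset.sum_comm' fun ω y => by
          simp only [Finset.mem_filter, Finset.mem_univ, true_and, and_true, v.comm']
    _ = ∑ y, p y * ((∑ ω with v y ω, p ω / classMass p (u ⊓ v) ω * classMass p u ω) /
          classMass p k y) := by
        refine Finset.sum_congr rfl fun y _ => ?_
        rw [Finset.sum_div, Finset.mul_sum]
        refine Finset.sum_congr rfl fun ω hω => ?_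
        rw [classMass_congr (hv (Finset.mem_filter.1 hω).2)]
    _ ≤ ∑ y, p y := Finset.sum_le_sum fun y _ => mul_le_of_le_one_right (hp y).le
        (div_le_one_of_le₀ (sum_class_mul_classMass_le hp hu hv y) (classMass_pos hp k y).le)

theorem partitionEntropy_submodular (hp : ∀ ω, 0 < p ω) (hu : u ≤ k) (hv : v ≤ k) :
    partitionEntropy p (u ⊓ v) + partitionEntropy p k ≤
      partitionEntropy p u + partitionEntropy p v := by
  have hlog (ω : Ω) : p ω * Real.log (classMass p u ω) + p ω * Real.log (classMass p v ω) -
      p ω * Real.log (classMass p (u ⊓ v) ω) - p ω * Real.log (classMass p k ω) ≤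
      p ω * (classMass p u ω * classMass p v ω / (classMass p (u ⊓ v) ω * classMass p k ω)) -
        p ω := by
    have hM (r : Setoid Ω) := classMass_pos hp r ω
    have h := Real.log_le_sub_one_of_pos
      (div_pos (mul_pos (hM u) (hM v)) (mul_pos (hM (u ⊓ v)) (hM k)))
    rw [Real.log_div (mul_pos (hM u) (hM v)).ne' (mul_pos (hM (u ⊓ v)) (hM k)).ne',
      Real.log_mul (hM u).ne' (hM v).ne', Real.log_mul (hM (u ⊓ v)).ne' (hM k).ne'] at h
    linarith [mul_le_mul_of_nonneg_left h (hp ω).le]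
  have hsum := Finset.sum_le_sum fun ω (_ : ω ∈ Finset.univ) => hlog ω
  simp only [Finset.sum_sub_distrib, Finset.sum_add_distrib] at hsum
  unfold partitionEntropy
  linarith [sum_mul_classMass_le hp hu hv]

theorem isPolymatroid_partitionEntropy (hp : ∀ ω, 0 < p ω) (hsum : ∑ ω, p ω = 1) :
    IsPolymatroid (partitionEntropy p) where
  antitone := (partitionEntropy_strictAnti hp).antitone
  submodular := partitionEntropy_submodular hp
  map_top := by simp only [partitionEntropy, classMass_top hsum, Real.log_one, mul_zero,
    Finset.sum_const_zero, neg_zero]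

theorem partitionEntropy_comap {π : Ω' → Ω}
    (hπ : ∀ f : Ω → ℝ, ∑ z, q z * f (π z) = ∑ ω, p ω * f ω) (r : Setoid Ω) :
    partitionEntropy q (r.comap π) = partitionEntropy p r := by
  have hmass (z : Ω') : classMass q (r.comap π) z = classMass p r (π z) := by
    simpa only [classMass, Finset.sum_filter, Setoid.comap_rel, mul_ite, mul_one, mul_zero]
      using hπ fun ω => if r (π z) ω then 1 else 0
  simp only [partitionEntropy, hmass, hπ fun ω => Real.log (classMass p r ω)]

/-- The pairs of outcomes in the same class of `k`. -/
abbrev CopySpace (k : Setoid Ω) : Type _ :=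
  {z : Ω × Ω // k z.1 z.2}

instance (k : Setoid Ω) : Fintype (CopySpace k) :=
  Fintype.ofFinite _

/-- The weight of two copies of the outcome which agree on `k` and are conditionally independent
given `k`. -/
def copyWeight (p : Ω → ℝ) (k : Setoid Ω) (z : CopySpace k) : ℝ :=
  p z.1.1 * p z.1.2 / classMass p k z.1.1

theorem copyWeight_pos (hp : ∀ ω, 0 < p ω) (z : CopySpace k) : 0 < copyWeight p k z :=
  div_pos (mul_pos (hp _) (hp _)) (classMass_pos hp k _)

theorem sum_copySpace (k : Setoid Ω) (f : Ω → Ω → ℝ) :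
    ∑ z : CopySpace k, f z.1.1 z.1.2 = ∑ x, ∑ y with k x y, f x y := by
  rw [← Finset.sum_subtype (Finset.univ.filter fun z : Ω × Ω => k z.1 z.2) (by simp)
    fun z => f z.1 z.2, Finset.sum_filter, Fintype.sum_prod_type]
  simp only [Finset.sum_filter]

theorem sum_copyWeight_mul_fst (hp : ∀ ω, 0 < p ω) (f : Ω → ℝ) :
    ∑ z, copyWeight p k z * f z.1.1 = ∑ x, p x * f x := by
  refine (sum_copySpace k fun x y => p x * p y / classMass p k x * f x).trans
    (Finset.sum_congr rfl fun x _ => ?_)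
  rw [← Finset.sum_mul, ← Finset.sum_div, ← Finset.mul_sum, ← classMass,
    mul_div_cancel_right₀ _ (classMass_pos hp k x).ne']

theorem sum_copyWeight_mul_snd (hp : ∀ ω, 0 < p ω) (f : Ω → ℝ) :
    ∑ z, copyWeight p k z * f z.1.2 = ∑ x, p x * f x := by
  rw [← sum_copyWeight_mul_fst (k := k) hp]
  refine Fintype.sum_equiv ((Equiv.prodComm Ω Ω).subtypeEquiv fun z => k.comm') _ _ fun z => ?_
  change copyWeight p k z * f z.1.2 = p z.1.2 * p z.1.1 / classMass p k z.1.2 * f z.1.2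
  rw [copyWeight, classMass_congr z.2, mul_comm (p z.1.1)]

theorem sum_copyWeight (hp : ∀ ω, 0 < p ω) : ∑ z, copyWeight p k z = ∑ x, p x := by
  simpa only [mul_one] using sum_copyWeight_mul_fst (k := k) hp fun _ => 1

theorem classMass_copy (hu : u ≤ k) (v : Setoid Ω) (z : CopySpace k) :
    classMass (copyWeight p k) (u.comap (·.1.1) ⊓ v.comap (·.1.2)) z =
      classMass p u z.1.1 * classMass p (k ⊓ v) z.1.2 / classMass p k z.1.1 := by
  obtain ⟨⟨x, y⟩, hxy⟩ := z
  have hiff {x' : Ω} (hx : u x x') (y' : Ω) : k x' y' ∧ v y y' ↔ (k ⊓ v) y y' :=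
    and_congr_left' ⟨k.trans (k.trans (k.symm hxy) (hu hx)),
      k.trans (k.trans (k.symm (hu hx)) hxy)⟩
  calc classMass (copyWeight p k) (u.comap (·.1.1) ⊓ v.comap (·.1.2)) ⟨(x, y), hxy⟩
      = ∑ z : CopySpace k, if u x z.1.1 ∧ v y z.1.2 then copyWeight p k z else 0 := by
        rw [classMass, Finset.sum_filter]
        congr!
    _ = ∑ x', ∑ y' with k x' y',
          if u x x' ∧ v y y' then p x' * p y' / classMass p k x' else 0 :=
        sum_copySpace k fun x' y' => if u x x' ∧ v y y' then p x' * p y' / classMass p k x' else 0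
    _ = ∑ x' with u x x', p x' * classMass p (k ⊓ v) y / classMass p k x := by
        rw [Finset.sum_filter]
        refine Finset.sum_congr rfl fun x' _ => ?_
        split_ifs with hx
        · rw [classMass_congr (hu hx)]
          simp only [hx, true_and, ← Finset.sum_filter, Finset.filter_filter, hiff hx, classMass,
            Finset.mul_sum, Finset.sum_div]
        · simp only [hx, false_and, if_false, Finset.sum_const_zero]
    _ = classMass p u x * classMass p (k ⊓ v) y / classMass p k x := by
        simp only [classMass, Finset.sum_mul, Finset.sum_div]

theorem partitionEntropy_copy (hp : ∀ ω, 0 < p ω) (hu : u ≤ k) (v : Setoid Ω) :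
    partitionEntropy (copyWeight p k) (u.comap (·.1.1) ⊓ v.comap (·.1.2)) =
      partitionEntropy p u + partitionEntropy p (k ⊓ v) - partitionEntropy p k := by
  have hlog (z : CopySpace k) :
      Real.log (classMass (copyWeight p k) (u.comap (·.1.1) ⊓ v.comap (·.1.2)) z) =
        Real.log (classMass p u z.1.1) + Real.log (classMass p (k ⊓ v) z.1.2) -
          Real.log (classMass p k z.1.1) := by
    have hM (r : Setoid Ω) (ω : Ω) := (classMass_pos hp r ω).ne'
    rw [classMass_copy hu, Real.log_div (mul_ne_zero (hM _ _) (hM _ _)) (hM _ _),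
      Real.log_mul (hM _ _) (hM _ _)]
  simp only [partitionEntropy, hlog, mul_sub, mul_add, Finset.sum_sub_distrib,
    Finset.sum_add_distrib]
  rw [sum_copyWeight_mul_fst hp fun x => Real.log (classMass p u x),
    sum_copyWeight_mul_fst hp fun x => Real.log (classMass p k x),
    sum_copyWeight_mul_snd hp fun x => Real.log (classMass p (k ⊓ v) x)]
  ring

end PartitionEntropy

/-- Pulling partitions back along a map, as a homomorphism of semilattices. -/
def comapInfHom {Ω Ω' : Type*} (π : Ω' → Ω) : InfHom (Setoid Ω) (Setoid Ω') where
  toFun := Setoid.comap π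
  map_inf' _ _ := rfl

theorem isCopy_partitionEntropy {Ω : Type*} [Fintype Ω] {p : Ω → ℝ} (hp : ∀ ω, 0 < p ω)
    (k : Setoid Ω) :
    IsCopy (partitionEntropy p) (partitionEntropy (copyWeight p k)) k (comapInfHom (·.1.1))
      (comapInfHom (·.1.2)) where
  apply_fst := partitionEntropy_comap (sum_copyWeight_mul_fst hp)
  apply_snd := partitionEntropy_comap (sum_copyWeight_mul_snd hp)
  map_eq {r} hr := Setoid.ext fun z w =>
    ⟨fun h => r.trans (r.trans (r.symm (hr z.2)) h) (hr w.2),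
      fun h => r.trans (r.trans (hr z.2) h) (r.symm (hr w.2))⟩
  apply_inf v hu := partitionEntropy_copy hp hu v

section Support

variable {Ω β γ : Type*} [MeasurableSpace Ω] {μ : Measure Ω}

/-- The values of positive probability of a random variable. -/
abbrev Support (μ : Measure Ω) (Y : Ω → β) : Type _ :=
  {y : β // μ.real (Y ⁻¹' {y}) ≠ 0}

instance [Finite β] (Y : Ω → β) : Fintype (Support μ Y) :=
  Fintype.ofFinite _

/-- The distribution of a random variable on its support. -/
def supportWeight (μ : Measure Ω) (Y : Ω → β) (y : Support μ Y) : ℝ :=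
  μ.real (Y ⁻¹' {y.1})

theorem supportWeight_pos (Y : Ω → β) (y : Support μ Y) : 0 < supportWeight μ Y y :=
  measureReal_nonneg.lt_of_ne' y.2

theorem partitionEntropy_ker [Fintype β] [DecidableEq γ] [Fintype γ] (p : β → ℝ) (f : β → γ) :
    partitionEntropy p (Setoid.ker f) = ∑ c, Real.negMulLog (∑ y with f y = c, p y) := by
  have hmass (y : β) : classMass p (Setoid.ker f) y = ∑ x with f x = f y, p x := by
    unfold classMass
    congr! 2
    exact Setoid.ker_def.trans eq_comm
  rw [partitionEntropy, ← Finset.sum_fiberwise _ f, ← Finset.sum_neg_distrib]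
  refine Finset.sum_congr rfl fun c _ => ?_
  rw [Real.negMulLog, neg_mul, Finset.sum_mul]
  refine congrArg Neg.neg (Finset.sum_congr rfl fun y hy => ?_)
  rw [hmass, (Finset.mem_filter.1 hy).2]

variable [Finite β] [MeasurableSpace β] [MeasurableSingletonClass β] {Y : Ω → β}

theorem measureReal_preimage_eq_sum [IsFiniteMeasure μ] (hY : Measurable Y) (P : β → Prop)
    [DecidablePred P] :
    μ.real (Y ⁻¹' {y | P y}) = ∑ y : Support μ Y with P y.1, supportWeight μ Y y := by
  classical
  cases nonempty_fintype β
  have hP : {y | P y} = ((Finset.univ.filter P : Finset β) : Set β) := by simp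
  calc μ.real (Y ⁻¹' {y | P y})
      = ∑ y, if P y then μ.real (Y ⁻¹' {y}) else 0 := by
        rw [hP, ← sum_measureReal_preimage_singleton _ fun y _ => hY (measurableSet_singleton y),
          Finset.sum_filter]
    _ = ∑ y with μ.real (Y ⁻¹' {y}) ≠ 0, if P y then μ.real (Y ⁻¹' {y}) else 0 :=
        (Finset.sum_filter_of_ne fun y _ hy => (ite_ne_right_iff.1 hy).2).symm
    _ = ∑ y : Support μ Y, if P y.1 then supportWeight μ Y y else 0 :=
        Finset.sum_subtype _ (fun y => by simp) _
    _ = ∑ y : Support μ Y with P y.1, supportWeight μ Y y := (Finset.sum_filter _ _).symm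

theorem sum_supportWeight [IsProbabilityMeasure μ] (hY : Measurable Y) :
    ∑ y, supportWeight μ Y y = 1 := by
  simpa using (measureReal_preimage_eq_sum (μ := μ) hY fun _ => True).symm

theorem entropy_comp [IsFiniteMeasure μ] [Fintype γ] (hY : Measurable Y) (f : β → γ) :
    SecretSharing.entropy μ (f ∘ Y) =
      partitionEntropy (supportWeight μ Y) (Setoid.ker fun y => f y.1) := by
  classical
  rw [partitionEntropy_ker]
  exact Finset.sum_congr rfl fun c _ =>
    congrArg Real.negMulLog (measureReal_preimage_eq_sum hY fun y => f y = c)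

end Support

section Scheme

variable {Ω ι : Type*} [MeasurableSpace Ω] {μ : Measure Ω} {α : ι → Type*} {S : (i : ι) → Ω → α i}

/-- The partition of the support of `(S_i)_i` according to the value of `S_i`. -/
def sharePartition (μ : Measure Ω) (S : (i : ι) → Ω → α i) (i : ι) :
    Setoid (Support μ fun ω i => S i ω) :=
  Setoid.ker fun y => y.1 i

theorem ker_restrict_eq_inf_sharePartition (V : Finset ι) :
    Setoid.ker (fun (y : Support μ fun ω i => S i ω) (i : V) => y.1 i) =
      V.inf (sharePartition μ S) :=
  le_antisymm (Finset.le_inf fun i hi _ _ h => congrFun h ⟨i, hi⟩)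
    fun _ _ h => funext fun i => Finset.inf_le (f := sharePartition μ S) i.2 h

variable [Finite ι] [∀ i, Fintype (α i)]

/-- The entropy of a function of `(S_i)_i`, given as a partition of its support. -/
abbrev shareEntropy (μ : Measure Ω) (S : (i : ι) → Ω → α i) :
    Setoid (Support μ fun ω i => S i ω) → ℝ :=
  partitionEntropy (supportWeight μ fun ω i => S i ω)

variable [∀ i, MeasurableSpace (α i)] [∀ i, MeasurableSingletonClass (α i)]

theorem isPolymatroid_shareEntropy [IsProbabilityMeasure μ] (hS : ∀ i, Measurable (S i)) :
    IsPolymatroid (shareEntropy μ S) :=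
  isPolymatroid_partitionEntropy (supportWeight_pos _)
    (sum_supportWeight (measurable_pi_lambda _ hS))

variable [IsFiniteMeasure μ]

theorem entropy_eq_shareEntropy (hS : ∀ i, Measurable (S i)) (i : ι) :
    SecretSharing.entropy μ (S i) = shareEntropy μ S (sharePartition μ S i) :=
  entropy_comp (measurable_pi_lambda _ hS) fun y => y i

variable [DecidableEq ι]

theorem condEntropy_eq_shareEntropy (hS : ∀ i, Measurable (S i)) (i : ι) (V : Finset ι) :
    SecretSharing.condEntropy μ S {i} V =
      shareEntropy μ S (sharePartition μ S i ⊓ V.inf (sharePartition μ S)) -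
        shareEntropy μ S (V.inf (sharePartition μ S)) := by
  have htuple (V : Finset ι) : SecretSharing.entropy μ (SecretSharing.tuple S V) =
      shareEntropy μ S (V.inf (sharePartition μ S)) := by
    rw [← ker_restrict_eq_inf_sharePartition]
    exact entropy_comp (measurable_pi_lambda _ hS) fun y (i : V) => y i
  rw [SecretSharing.condEntropy, htuple, htuple, Finset.inf_union, Finset.inf_singleton]

theorem inf_sharePartition_le {n : ℕ} {α : Fin (n + 1) → Type*} [∀ i, Fintype (α i)]
    [∀ i, MeasurableSpace (α i)] [∀ i, MeasurableSingletonClass (α i)]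
    {S : (i : Fin (n + 1)) → Ω → α i} {M : Set (Finset (Fin (n + 1)))}
    (hS : ∀ i, Measurable (S i)) (hperfect : SecretSharing.IsPerfectScheme μ S M)
    {V : Finset (Fin (n + 1))} (hV : V ∈ M) :
    V.inf (sharePartition μ S) ≤ sharePartition μ S 0 := by
  refine le_of_partitionEntropy_inf_eq (supportWeight_pos _) (sub_eq_zero.1 ?_)
  rw [← condEntropy_eq_shareEntropy hS, hperfect.correct V hV]

theorem shareEntropy_secret_inf {n : ℕ} {α : Fin (n + 1) → Type*} [∀ i, Fintype (α i)]
    [∀ i, MeasurableSpace (α i)] [∀ i, MeasurableSingletonClass (α i)]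
    {S : (i : Fin (n + 1)) → Ω → α i} {M : Set (Finset (Fin (n + 1)))}
    (hS : ∀ i, Measurable (S i)) (hperfect : SecretSharing.IsPerfectScheme μ S M)
    {V : Finset (Fin (n + 1))} (h0 : 0 ∉ V) (hV : ∀ Q ∈ M, ¬ Q ⊆ V) :
    shareEntropy μ S (sharePartition μ S 0 ⊓ V.inf (sharePartition μ S)) =
      shareEntropy μ S (V.inf (sharePartition μ S)) +
        shareEntropy μ S (sharePartition μ S 0) := by
  rw [← entropy_eq_shareEntropy hS, ← hperfect.priv V h0 hV, condEntropy_eq_shareEntropy hS,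
    add_sub_cancel]

end Scheme

section VamosScheme

instance : DecidablePred (· ∈ SecretSharing.vamosMinimalQualified) :=
  fun _ => inferInstanceAs (Decidable (_ ∨ _ ∨ _))

variable {Ω : Type*} [MeasurableSpace Ω] {μ : Measure Ω} [IsProbabilityMeasure μ]
  {α : Fin 8 → Type*} [∀ i, Fintype (α i)] [∀ i, MeasurableSpace (α i)]
  [∀ i, MeasurableSingletonClass (α i)] {S : (i : Fin 8) → Ω → α i}

theorem isVamosPort_of_isPerfectScheme (hS : ∀ i, Measurable (S i))
    (hperfect : SecretSharing.IsPerfectScheme μ S SecretSharing.vamosMinimalQualified) :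
    IsVamosPort (shareEntropy μ S) (sharePartition μ S 0) (sharePartition μ S 1)
      (sharePartition μ S 2) (sharePartition μ S 3) (sharePartition μ S 4) (sharePartition μ S 5)
      (sharePartition μ S 6 ⊓ sharePartition μ S 7) := by
  have hdet (V : Finset (Fin 8)) {y} (hy : V.inf (sharePartition μ S) = y)
      (hV : V ∈ SecretSharing.vamosMinimalQualified) : y ≤ sharePartition μ S 0 :=
    hy ▸ inf_sharePartition_le hS hperfect hV
  have hindep (V : Finset (Fin 8)) {y} (hy : V.inf (sharePartition μ S) = y) (h0 : 0 ∉ V)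
      (hV : ∀ Q ∈ SecretSharing.vamosMinimalQualified, ¬ Q ⊆ V) :
      shareEntropy μ S (sharePartition μ S 0 ⊓ y) =
        shareEntropy μ S y + shareEntropy μ S (sharePartition μ S 0) :=
    hy ▸ shareEntropy_secret_inf hS hperfect h0 hV
  have hinf (i j k l : Fin 8) : ({i, j, k, l} : Finset (Fin 8)).inf (sharePartition μ S) =
      sharePartition μ S i ⊓
        (sharePartition μ S j ⊓ (sharePartition μ S k ⊓ sharePartition μ S l)) := by
    simp only [Finset.inf_insert, Finset.inf_singleton]
  exact
    { det₁₂₃ := hdet {1, 2, 3} (by simp) (by decide)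
      det₁₄₅ := hdet {1, 4, 5} (by simp) (by decide)
      det₁₃ := hdet {1, 3, 6, 7} (by rw [hinf]; ac_rfl) (by decide)
      det₁₄ := hdet {1, 4, 6, 7} (by rw [hinf]; ac_rfl) (by decide)
      det₁₅ := hdet {1, 5, 6, 7} (by rw [hinf]; ac_rfl) (by decide)
      det₃₄ := hdet {3, 4, 6, 7} (by rw [hinf]; ac_rfl) (by decide)
      det₃₅ := hdet {3, 5, 6, 7} (by rw [hinf]; ac_rfl) (by decide)
      indep₁ := hindep {1} Finset.inf_singleton (by decide) (by decide +kernel)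
      indep₁₆₇ := hindep {1, 6, 7} (by simp) (by decide) (by decide +kernel)
      indep₂₃₄₅ := hindep {2, 3, 4, 5} (by rw [hinf]; ac_rfl) (by decide) (by decide +kernel)
      indep₂₃₆₇ := hindep {2, 3, 6, 7} (by rw [hinf]; ac_rfl) (by decide) (by decide +kernel)
      indep₄₅₆₇ := hindep {4, 5, 6, 7} (by rw [hinf]; ac_rfl) (by decide) (by decide +kernel) }

theorem eight_mul_entropy_secret_le (hS : ∀ i, Measurable (S i))
    (hperfect : SecretSharing.IsPerfectScheme μ S SecretSharing.vamosMinimalQualified) {ρ : ℝ}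
    (hρ : ∀ i : Fin 7, SecretSharing.entropy μ (S i.succ) ≤ ρ) :
    8 * SecretSharing.entropy μ (S 0) ≤ 7 * ρ := by
  have hp := supportWeight_pos (μ := μ) fun ω i => S i ω
  have hH := isPolymatroid_shareEntropy (μ := μ) hS
  have hp₁ := copyWeight_pos (k := sharePartition μ S 4 ⊓ sharePartition μ S 5 ⊓
    (sharePartition μ S 2 ⊓ sharePartition μ S 3)) hp
  have hsum := sum_supportWeight (μ := μ) (measurable_pi_lambda _ hS)
  simp only [entropy_eq_shareEntropy hS] at hρ ⊢
  exact (isVamosPort_of_isPerfectScheme hS hperfect).eight_mul_secret_le hH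
    (isPolymatroid_partitionEntropy hp₁ ((sum_copyWeight hp).trans hsum))
    (isPolymatroid_partitionEntropy (copyWeight_pos hp₁)
      ((sum_copyWeight hp₁).trans ((sum_copyWeight hp).trans hsum)))
    (isCopy_partitionEntropy hp _) (isCopy_partitionEntropy hp₁ _)
    (hρ 0) (hρ 1) (hρ 2) (hρ 3) (hρ 4)

end VamosScheme

end

theorem mainTheorem1_general {Ω : Type*} [MeasurableSpace Ω] (μ : Measure Ω)
    [IsProbabilityMeasure μ] {α : Fin 8 → Type*} [∀ i, Fintype (α i)] [∀ i, MeasurableSpace (α i)]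
    [∀ i, MeasurableSingletonClass (α i)] (S : (i : Fin 8) → Ω → α i)
    (hS : ∀ i, Measurable (S i))
    (hperfect : SecretSharing.IsPerfectScheme μ S SecretSharing.vamosMinimalQualified)
    (hsecret : 0 < SecretSharing.entropy μ (S 0)) :
    (8 / 7 : ℝ) ≤ SecretSharing.informationRatio μ S := by
  rw [SecretSharing.informationRatio, div_le_div_iff₀ (by norm_num) hsecret, mul_comm _ 7]
  exact eight_mul_entropy_secret_le hS hperfect fun i =>
    Finset.le_sup' (fun i : Fin 7 => SecretSharing.entropy μ (S i.succ)) (Finset.mem_univ i)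

theorem mainTheorem1 {Ω : Type*} [MeasurableSpace Ω] (μ : Measure Ω) [IsProbabilityMeasure μ]
    {α : Fin 8 → Type*} [∀ i, Fintype (α i)] [∀ i, MeasurableSpace (α i)]
    [∀ i, MeasurableSingletonClass (α i)] (S : (i : Fin 8) → Ω → α i)
    (hS : ∀ i, Measurable (S i))
    (hperfect : SecretSharing.IsPerfectScheme μ S SecretSharing.vamosMinimalQualified)
    (hsecret : 0 < SecretSharing.entropy μ (S 0)) :
    (561 / 491 : ℝ) ≤ SecretSharing.informationRatio μ S :=
  (by norm_num : (561 / 491 : ℝ) ≤ 8 / 7).trans (mainTheorem1_general μ S hS hperfect hsecret)
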